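/- Let $n\ge 1$. A *convex domain* is a non-empty bounded open convex set $\mathcal C\subset\mathbb R^n$. For $x\in\mathcal C$ and $v\in\mathbb R^n\setminus\{0\}$, let $x^{+},x^{-}$ be the two points where the line through $x$ with direction $v$ meets $\partial\mathcal C$; the Hilbert Finsler norm of $\mathcal C$ is $$F_{\mathcal C}(x,v)=\tfrac12\|v\|\Bigl(\frac1{\|x-x^-\|}+\frac1{\|x-x^+\|}\Bigr),\qquad F_{\mathcal C}(x,0)=0 .$$ Two points of a closed convex set $K$ are equivalent if they are equal or some segment $[c,d]\subset K$ contains both of them, neither being $c$ or $d$. The equivalence classes are the *faces* of $K$ (they are relatively open); a $k$-face is a face whose affine span has dimension $k$. A $k$-face $f$ of $K$ is *conical* if there is an $n$-simplex $T\supset K$ such that $f$ is contained in a $k$-face of $T$. The faces of a convex domain are those of its closure. **Proposition.** Let $\mathcal A,\mathcal B\subset\mathbb R^n$ be convex domains and let $\mathcal S$ be a closed $n$-simplex contained in $\overline{\mathcal A}\cap\overline{\mathcal B}$, with vertices $v_0,\dots,v_n$. For $0\le k\le n$ let $\mathcal F_k$ be the $k$-face of $\mathcal S$ with vertices $v_0,\dots,v_k$.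 Suppose that 1. $\mathcal F_{n-1}$ is the one and only $(n-1)$-face of $\mathcal S$ whose closure is contained in $\partial\mathcal A\cap\partial\mathcal B$; 2. for every $0\le k\le n$, $\mathcal F_k$ is the one and only $k$-face of $\mathcal S$ that is contained both in a $k$-face of $\mathcal A$ and in a $k$-face of $\mathcal B$; 3. for every $0\le k\le n$, the $k$-face $\mathcal A_k$ of $\mathcal A$ containing $\mathcal F_k$ and the $k$-face $\mathcal B_k$ of $\mathcal B$ containing $\mathcal F_k$ are conical, and $v_k\in\mathcal A_k\cap\mathcal B_k$. Then there is a constant $C>0$ such that for all $x\in\mathcal S\cap\mathcal A\cap\mathcal B$ and all $v\in\mathbb R^n$ $$\frac1C\,F_{\mathcal B}(x,v)\le F_{\mathcal A}(x,v)\le C\,F_{\mathcal B}(x,v).$$ -/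

import Mathlib

/-- A convex domain of `ℝⁿ`: a non-empty bounded open convex set. -/
structure IsConvexDomain {n : ℕ} (C : Set (EuclideanSpace ℝ (Fin n))) : Prop where
  nonempty : C.Nonempty
  isOpen : IsOpen C
  convex : Convex ℝ C
  isBounded : Bornology.IsBounded C

/-- The point at which the half-line that starts at `p` with direction `v` leaves `C`
(a point of the boundary of `C` if `C` is a convex domain, `p ∈ C` and `v ≠ 0`). -/
noncomputable def exitPoint {n : ℕ} (C : Set (EuclideanSpace ℝ (Fin n)))
    (p v : EuclideanSpace ℝ (Fin n)) : EuclideanSpace ℝ (Fin n) :=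
  p + sSup {t : ℝ | 0 ≤ t ∧ p + t • v ∈ C} • v

/-- The Finsler norm of the Hilbert geometry of `C`: with `p⁺` and `p⁻` the two points at which
the line through `p` with direction `v` meets the boundary of `C`,
`F_C(p, v) = ½ ‖v‖ (1 / ‖p - p⁻‖ + 1 / ‖p - p⁺‖)`, and `F_C(p, 0) = 0`. -/
noncomputable def hilbertFinsler {n : ℕ} (C : Set (EuclideanSpace ℝ (Fin n)))
    (p v : EuclideanSpace ℝ (Fin n)) : ℝ :=
  1 / 2 * ‖v‖ * (1 / ‖p - exitPoint C p (-v)‖ + 1 / ‖p - exitPoint C p v‖)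

/-- Two points of the closed convex set `K` are equivalent if they are equal or if some segment
`[c, d] ⊆ K` contains both of them, neither being an end point of it. (Equal points are covered
by the degenerate segment `c = d`, for which `openSegment ℝ c c = {c}`.) -/
def FaceEquiv {n : ℕ} (K : Set (EuclideanSpace ℝ (Fin n)))
    (x y : EuclideanSpace ℝ (Fin n)) : Prop :=
  ∃ c d, segment ℝ c d ⊆ K ∧ x ∈ openSegment ℝ c d ∧ y ∈ openSegment ℝ c d

/-- `f` is a `k`-dimensional face of the closed convex set `K`: an equivalence class of
`FaceEquiv K` (hence relatively open) whose affine span has dimension `k`. -/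
def IsKFace {n : ℕ} (k : ℕ) (K f : Set (EuclideanSpace ℝ (Fin n))) : Prop :=
  (∃ x ∈ K, f = {y | FaceEquiv K x y}) ∧ Module.finrank ℝ (vectorSpan ℝ f) = k

/-- `f` is a conical `k`-face of the closed convex set `K`: it is a `k`-face of `K`, and there is
an `n`-simplex that contains `K` and one of whose `k`-faces contains `f`. -/
def IsConicalKFace {n : ℕ} (k : ℕ) (K f : Set (EuclideanSpace ℝ (Fin n))) : Prop :=
  IsKFace k K f ∧ ∃ T : Affine.Simplex ℝ (EuclideanSpace ℝ (Fin n)) n,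
    K ⊆ T.closedInterior ∧ ∃ g, IsKFace k T.closedInterior g ∧ f ⊆ g

/-- The face of the simplex `S` spanned by its first vertices `v₀, …, vₖ`: the relative interior
of their convex hull. -/
def flagFace {n : ℕ} (S : Affine.Simplex ℝ (EuclideanSpace ℝ (Fin n)) n) (k : ℕ) :
    Set (EuclideanSpace ℝ (Fin n)) :=
  intrinsicInterior ℝ (convexHull ℝ (S.points '' {i | (i : ℕ) ≤ k}))

open Set Filter Topology

/-! ### Faces and feasible directions -/

section Faces

variable {n : ℕ} {K : Set (EuclideanSpace ℝ (Fin n))} {x y z u : EuclideanSpace ℝ (Fin n)}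

/-! By symmetry it suffices to find a uniform `c > 0` such that, for `x` in the simplex, `x ± u ∈
closure B` forces `x + c • u ∈ closure A`. Up to a factor 2, the Finsler norm is the inverse of the
half-length of the longest segment centred at `x`, so `hilbertFinsler_le` turns this into the norm
bound.

Let `l i` be the barycentric coordinates of `x`, `μ i` those of the vector `u`, and `σ i` the sum of
the `l m` with `m ≥ i`. Upper bound (`exists_abs_coord_linear_le`): a simplex witnessing that the
`k`-face of `B` is conical has facet functions that are nonnegative on `B` and vanish at `v₀, …,
vₖ`. At `x` they are at most a constant times `σ (k + 1)`, and positivity at `x ± u` bounds their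
linear parts at `u` by the same quantity. They cut out exactly the flag direction, so `|μ i| ≤ M * σ
i` for `i ≥ 1`.

Construction (`exists_pos_forall_points_add_sum_mem`): each `vᵢ` lies in the relatively open
`i`-face of `A`, hence can be moved by small multiples `δ j` of `vⱼ - v₀`, `j ≤ i`, inside `closure
A`. Averaging with weights `l i` moves `x` by `∑ δ j * σ j • (vⱼ - v₀)`, and `δ j = c * μ j / σ j`
makes this `c • u`. -/

theorem FaceEquiv.symm (h : FaceEquiv K x y) : FaceEquiv K y x := by
  obtain ⟨c, d, hcd, hx, hy⟩ := h
  exact ⟨c, d, hcd, hy, hx⟩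

theorem FaceEquiv.left_mem (h : FaceEquiv K x y) : x ∈ K := by
  obtain ⟨c, d, hcd, hx, -⟩ := h
  exact hcd (openSegment_subset_segment ℝ c d hx)

/-- Equivalent points of a convex set have the same feasible directions. -/
theorem FaceEquiv.exists_pos_add_smul_mem (hK : Convex ℝ K) (h : FaceEquiv K x y)
    (hu : ∃ ε : ℝ, 0 < ε ∧ x + ε • u ∈ K) : ∃ ε : ℝ, 0 < ε ∧ y + ε • u ∈ K := by
  obtain ⟨c, d, hcd, ⟨p', p, hp', hp, hpp, rfl⟩, ⟨q', q, hq', hq, hqq, rfl⟩⟩ := h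
  obtain ⟨ε, hε, hmem⟩ := hu
  obtain rfl : p' = 1 - p := by linarith
  obtain rfl : q' = 1 - q := by linarith
  -- The target is `y + δε • u = δ • (x + ε • u) + (1 - δ) • e` with `e` at parameter `r` of `[c,
  -- d]`. This `δ` is small enough that `0 ≤ r ≤ 1` for every position `p` of `x`.
  set δ := q * (1 - q) with hδ
  have hδ0 : 0 < δ := mul_pos hq hq'
  have hδ1 : 0 < 1 - δ := by nlinarith
  set r := (q - δ * p) / (1 - δ) with hr
  have hr0 : 0 ≤ r := div_nonneg (by nlinarith) hδ1.le
  have hr1 : r ≤ 1 := (div_le_one hδ1).2 (by nlinarith)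
  have hrr : (1 - δ) * r = q - δ * p := mul_div_cancel₀ _ hδ1.ne'
  have he : (1 - r) • c + r • d ∈ K := hcd ⟨1 - r, r, by linarith, hr0, by ring, rfl⟩
  refine ⟨δ * ε, mul_pos hδ0 hε, ?_⟩
  have := hK hmem he hδ0.le hδ1.le (by ring)
  convert this using 1
  have h1 : (1 - δ) • ((1 - r) • c + r • d) =
      ((1 - δ) - (q - δ * p)) • c + (q - δ * p) • d := by
    rw [← hrr]; module
  rw [h1]; module

theorem exists_pos_add_smul_mem_of_mem_intrinsicInterior {s : Set (EuclideanSpace ℝ (Fin n))}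
    (hz : z ∈ intrinsicInterior ℝ s) (hu : u ∈ vectorSpan ℝ s) :
    ∃ ε : ℝ, 0 < ε ∧ z + ε • u ∈ s := by
  obtain ⟨w, hw, rfl⟩ := mem_intrinsicInterior.1 hz
  have hmem : ∀ t : ℝ, (w : EuclideanSpace ℝ (Fin n)) + t • u ∈ affineSpan ℝ s := by
    intro t
    rw [add_comm]
    refine AffineSubspace.vadd_mem_of_mem_direction ?_ w.2
    rw [direction_affineSpan]
    exact Submodule.smul_mem _ _ hu
  let φ : ℝ → affineSpan ℝ s := fun t ↦ ⟨w + t • u, hmem t⟩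
  have hφ : Continuous φ := by
    refine Continuous.subtype_mk ?_ _
    fun_prop
  have h0 : φ 0 = w := by simp [φ]
  have hev : ∀ᶠ t in 𝓝 (0 : ℝ), φ t ∈ interior ((↑) ⁻¹' s : Set (affineSpan ℝ s)) :=
    hφ.continuousAt.eventually_mem (by rw [h0]; exact isOpen_interior.mem_nhds hw)
  obtain ⟨ε, hε, hpos⟩ := ((hev.filter_mono nhdsWithin_le_nhds).and
    (self_mem_nhdsWithin : Ioi (0 : ℝ) ∈ 𝓝[>] 0)).exists
  have hmem : φ ε ∈ ((↑) ⁻¹' s : Set (affineSpan ℝ s)) := interior_subset hε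
  exact ⟨ε, hpos, hmem⟩

/-- Both directions of a line through `x` along which one can move within `K` belong to the
direction of the face of `x`. -/
theorem mem_vectorSpan_faceEquiv {u : EuclideanSpace ℝ (Fin n)} {ε : ℝ} (hK : Convex ℝ K)
    (hε : 0 < ε) (hp : x + ε • u ∈ K) (hm : x - ε • u ∈ K) :
    u ∈ vectorSpan ℝ {y | FaceEquiv K x y} := by
  have hseg : segment ℝ (x - ε • u) (x + ε • u) ⊆ K := hK.segment_subset hm hp
  have h1 : x ∈ openSegment ℝ (x - ε • u) (x + ε • u) :=
    ⟨1 / 2, 1 / 2, by norm_num, by norm_num, by norm_num, by module⟩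
  have h2 : x + (ε / 2) • u ∈ openSegment ℝ (x - ε • u) (x + ε • u) :=
    ⟨1 / 4, 3 / 4, by norm_num, by norm_num, by norm_num, by module⟩
  have := vsub_mem_vectorSpan ℝ (s := {y | FaceEquiv K x y})
    (show x + (ε / 2) • u ∈ _ from ⟨_, _, hseg, h1, h2⟩) (show x ∈ _ from ⟨_, _, hseg, h1, h1⟩)
  have h3 := Submodule.smul_mem _ (2 / ε) this
  convert h3 using 1
  rw [vsub_eq_sub, add_sub_cancel_left, smul_smul]
  field_simp
  simp

end Faces

/-! ### Barycentric coordinates and the flag of the simplex -/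

section Flags

variable {n : ℕ}

/-- The simplex as an affine basis. -/
noncomputable def Affine.Simplex.affineBasis
    (S : Affine.Simplex ℝ (EuclideanSpace ℝ (Fin n)) n) :
    AffineBasis (Fin (n + 1)) ℝ (EuclideanSpace ℝ (Fin n)) where
  toFun := S.points
  ind' := S.independent
  tot' := S.independent.affineSpan_eq_top_iff_card_eq_finrank_add_one.2 (by simp)

theorem Affine.Simplex.mem_closedInterior_iff_coord
    (S : Affine.Simplex ℝ (EuclideanSpace ℝ (Fin n)) n) {x : EuclideanSpace ℝ (Fin n)} :
    x ∈ S.closedInterior ↔ ∀ i, 0 ≤ S.affineBasis.coord i x := by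
  rw [← Affine.Simplex.convexHull_eq_closedInterior]
  have := S.affineBasis.convexHull_eq_nonneg_coord
  exact Set.ext_iff.1 this x

theorem Affine.Simplex.convex_closedInterior
    (S : Affine.Simplex ℝ (EuclideanSpace ℝ (Fin n)) n) : Convex ℝ S.closedInterior := by
  rw [← Affine.Simplex.convexHull_eq_closedInterior]
  exact convex_convexHull ℝ _

/-- The direction of the face of `S` spanned by its first vertices `v₀, …, vₖ`. -/
noncomputable def flagDirection (S : Affine.Simplex ℝ (EuclideanSpace ℝ (Fin n)) n) (k : ℕ) :
    Submodule ℝ (EuclideanSpace ℝ (Fin n)) :=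
  vectorSpan ℝ (S.points '' {i | (i : ℕ) ≤ k})

variable (S : Affine.Simplex ℝ (EuclideanSpace ℝ (Fin n)) n) {k : ℕ}

theorem flagDirection_eq_vectorSpan_convexHull :
    flagDirection S k = vectorSpan ℝ (convexHull ℝ (S.points '' {i | (i : ℕ) ≤ k})) := by
  rw [flagDirection, ← direction_affineSpan, ← direction_affineSpan, affineSpan_convexHull]

theorem finrank_flagDirection (hk : k ≤ n) : Module.finrank ℝ (flagDirection S k) = k := by
  classical
  have := S.independent.finrank_vectorSpan_image_finset
    (s := Finset.univ.filter fun i : Fin (n + 1) ↦ (i : ℕ) ≤ k) (n := k) (by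
      have := Fin.card_Iic (⟨k, by omega⟩ : Fin (n + 1))
      rw [← this]
      congr 1
      ext i
      simp [Fin.le_def])
  rw [Finset.coe_image, Finset.coe_filter_univ] at this
  exact this

theorem sub_mem_flagDirection {i j : Fin (n + 1)} (hi : (i : ℕ) ≤ k) (hj : (j : ℕ) ≤ k) :
    S.points i - S.points j ∈ flagDirection S k :=
  vsub_mem_vectorSpan ℝ (mem_image_of_mem _ hi) (mem_image_of_mem _ hj)

theorem flagFace_nonempty : (flagFace S k).Nonempty :=
  (intrinsicInterior_nonempty (convex_convexHull ℝ _)).2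
    (convexHull_nonempty_iff.2 ⟨_, mem_image_of_mem _ (show ((0 : Fin (n + 1)) : ℕ) ≤ k by simp)⟩)

end Flags

/-! ### Transversal bounds from conical faces -/

section Conical

variable {n : ℕ} (S T : Affine.Simplex ℝ (EuclideanSpace ℝ (Fin n)) n)
  {K : Set (EuclideanSpace ℝ (Fin n))} {x y z u : EuclideanSpace ℝ (Fin n)} {k : ℕ}

theorem convexHull_image_points_subset_closedInterior (s : Set (Fin (n + 1))) :
    convexHull ℝ (S.points '' s) ⊆ S.closedInterior := by
  rw [← Affine.Simplex.convexHull_eq_closedInterior]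
  exact convexHull_mono (image_subset_range _ _)

variable {S T}

/-- A face containing the face of the flag of `S` allows motion in all directions of the latter. -/
theorem FaceEquiv.exists_pos_add_smul_mem_of_flagFace_subset (hK : Convex ℝ K)
    (hSK : S.closedInterior ⊆ K) (hF : flagFace S k ⊆ {y | FaceEquiv K x y})
    (hxy : FaceEquiv K x y) (hu : u ∈ flagDirection S k) :
    ∃ ε : ℝ, 0 < ε ∧ y + ε • u ∈ K := by
  obtain ⟨z, hz⟩ := flagFace_nonempty S (k := k)
  rw [flagDirection_eq_vectorSpan_convexHull] at hu
  obtain ⟨ε, hε, hmem⟩ := exists_pos_add_smul_mem_of_mem_intrinsicInterior hz hu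
  have h : FaceEquiv K x z := hF hz
  refine hxy.exists_pos_add_smul_mem hK (h.symm.exists_pos_add_smul_mem hK ⟨ε, hε, ?_⟩)
  exact hSK (convexHull_image_points_subset_closedInterior S _ hmem)

theorem AffineBasis.coord_add {ι : Type*} {E : Type*} [AddCommGroup E] [Module ℝ E]
    (b : AffineBasis ι ℝ E) (i : ι) (x u : E) :
    b.coord i (x + u) = b.coord i x + (b.coord i).linear u := by
  rw [add_comm x u, ← vadd_eq_add, AffineMap.map_vadd, vadd_eq_add, add_comm]

/-- From `x` one can move both along `u` and along `-u` inside `T`; a nonnegative coordinate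
starting at zero cannot decrease either way. -/
theorem coord_linear_eq_zero_of_mem_flagDirection
    (hST : S.closedInterior ⊆ T.closedInterior)
    (hF : flagFace S k ⊆ {y | FaceEquiv T.closedInterior x y})
    {j : Fin (n + 1)} (hj : T.affineBasis.coord j x = 0) (hu : u ∈ flagDirection S k) :
    (T.affineBasis.coord j).linear u = 0 := by
  have hK := T.convex_closedInterior
  obtain ⟨w, hw⟩ := flagFace_nonempty S (k := k)
  have hx : FaceEquiv T.closedInterior x x := by
    obtain ⟨c, d, hcd, hx, -⟩ := hF hw
    exact ⟨c, d, hcd, hx, hx⟩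
  obtain ⟨ε, hε, h1⟩ := hx.exists_pos_add_smul_mem_of_flagFace_subset hK hST hF hu
  obtain ⟨δ, hδ, h2⟩ := hx.exists_pos_add_smul_mem_of_flagFace_subset hK hST hF (neg_mem hu)
  have h1 := T.mem_closedInterior_iff_coord.1 h1 j
  have h2 := T.mem_closedInterior_iff_coord.1 h2 j
  rw [AffineBasis.coord_add, hj, map_smul, zero_add, smul_eq_mul] at h1 h2
  rw [map_neg] at h2
  have h1 := nonneg_of_mul_nonneg_right h1 hε
  have h2 := nonneg_of_mul_nonneg_right h2 hδ
  linarith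

/-- The segment from `y` to `x` can be prolonged beyond `x` inside `T`, where a coordinate positive
at `y` and zero at `x` would become negative. -/
theorem FaceEquiv.coord_eq_zero (h : FaceEquiv T.closedInterior x y) {j : Fin (n + 1)}
    (hj : T.affineBasis.coord j x = 0) : T.affineBasis.coord j y = 0 := by
  have hK := T.convex_closedInterior
  have hxy : ∃ ε : ℝ, 0 < ε ∧ x + ε • (x - y) ∈ T.closedInterior := by
    refine h.symm.exists_pos_add_smul_mem hK ⟨1, one_pos, ?_⟩
    simpa using h.left_mem
  obtain ⟨ε, hε, h1⟩ := hxy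
  have h1 := T.mem_closedInterior_iff_coord.1 h1 j
  have h2 := T.mem_closedInterior_iff_coord.1 h.symm.left_mem j
  have h3 : (T.affineBasis.coord j).linear (x - y) =
      T.affineBasis.coord j x - T.affineBasis.coord j y := by
    rw [← vsub_eq_sub, AffineMap.linearMap_vsub, vsub_eq_sub]
  rw [AffineBasis.coord_add, hj, map_smul, zero_add, smul_eq_mul, h3, hj] at h1
  have h1 := nonneg_of_mul_nonneg_right h1 hε
  linarith

theorem coord_points_eq_zero (hST : S.closedInterior ⊆ T.closedInterior)
    (hF : flagFace S k ⊆ {y | FaceEquiv T.closedInterior x y})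
    {i j : Fin (n + 1)} (hj : T.affineBasis.coord j x = 0) (hi : (i : ℕ) ≤ k) :
    T.affineBasis.coord j (S.points i) = 0 := by
  obtain ⟨z, hz⟩ := flagFace_nonempty S (k := k)
  have hzj := (hF hz : FaceEquiv _ x z).coord_eq_zero hj
  have hd : S.points i - z ∈ flagDirection S k := by
    rw [flagDirection_eq_vectorSpan_convexHull]
    exact vsub_mem_vectorSpan ℝ (subset_convexHull ℝ _ (mem_image_of_mem _ hi))
      (intrinsicInterior_subset hz)
  rw [← add_sub_cancel z (S.points i), AffineBasis.coord_add, hzj,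
    coord_linear_eq_zero_of_mem_flagDirection hST hF hj hd, add_zero]

theorem exists_pos_forall_nonneg_add_mul {ι : Type*} [Finite ι] {a b : ι → ℝ}
    (ha : ∀ i, 0 ≤ a i) (hb : ∀ i, a i = 0 → b i = 0) :
    ∃ ε : ℝ, 0 < ε ∧ ∀ i, 0 ≤ a i + ε * b i ∧ 0 ≤ a i - ε * b i := by
  have key : ∀ᶠ ε in 𝓝 (0 : ℝ), ∀ i, 0 ≤ a i + ε * b i ∧ 0 ≤ a i - ε * b i := by
    refine eventually_all.2 fun i ↦ ?_
    rcases (ha i).eq_or_lt with h | h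
    · simp [← h, hb i h.symm]
    · refine Eventually.and ?_ ?_
      · have : Tendsto (fun ε : ℝ ↦ a i + ε * b i) (𝓝 0) (𝓝 (a i + 0 * b i)) :=
          Continuous.tendsto (by fun_prop) 0
        exact (this.eventually_const_lt (by simpa using h)).mono fun _ h ↦ h.le
      · have : Tendsto (fun ε : ℝ ↦ a i - ε * b i) (𝓝 0) (𝓝 (a i - 0 * b i)) :=
          Continuous.tendsto (by fun_prop) 0
        exact (this.eventually_const_lt (by simpa using h)).mono fun _ h ↦ h.le
  obtain ⟨ε, h, hε⟩ := ((key.filter_mono nhdsWithin_le_nhds).and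
    (self_mem_nhdsWithin : Ioi (0 : ℝ) ∈ 𝓝[>] 0)).exists
  exact ⟨ε, hε, h⟩

/-- If the `k`-face of the simplex `T` that contains `x` contains the `k`-face of the flag of `S`,
then the facets of `T` through `x` cut out the direction of the latter. -/
theorem mem_flagDirection_of_coord_linear_eq_zero (hk : k ≤ n)
    (hST : S.closedInterior ⊆ T.closedInterior) (hx : x ∈ T.closedInterior)
    (hF : flagFace S k ⊆ {y | FaceEquiv T.closedInterior x y})
    (hdim : Module.finrank ℝ (vectorSpan ℝ {y | FaceEquiv T.closedInterior x y}) = k)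
    (hu : ∀ j, T.affineBasis.coord j x = 0 → (T.affineBasis.coord j).linear u = 0) :
    u ∈ flagDirection S k := by
  have hK := T.convex_closedInterior
  have key : ∀ w, (∀ j, T.affineBasis.coord j x = 0 → (T.affineBasis.coord j).linear w = 0) →
      w ∈ vectorSpan ℝ {y | FaceEquiv T.closedInterior x y} := by
    intro w hw
    obtain ⟨ε, hε, h⟩ := exists_pos_forall_nonneg_add_mul (T.mem_closedInterior_iff_coord.1 hx) hw
    refine mem_vectorSpan_faceEquiv hK hε ?_ ?_
    · refine T.mem_closedInterior_iff_coord.2 fun j ↦ ?_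
      rw [AffineBasis.coord_add, map_smul]
      exact (h j).1
    · refine T.mem_closedInterior_iff_coord.2 fun j ↦ ?_
      rw [sub_eq_add_neg, AffineBasis.coord_add, map_neg, map_smul, ← sub_eq_add_neg]
      exact (h j).2
  have hle : flagDirection S k ≤ vectorSpan ℝ {y | FaceEquiv T.closedInterior x y} := fun w hw ↦
    key w fun j hj ↦ coord_linear_eq_zero_of_mem_flagDirection hST hF hj hw
  -- Both spaces have dimension `k`, so the inclusion is an equality.
  rw [Submodule.eq_of_le_of_finrank_eq hle ((finrank_flagDirection S hk).trans hdim.symm)]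
  exact key u hu

theorem coord_linear_eq_zero_of_lt {i : Fin (n + 1)} (hi : k < i) (hu : u ∈ flagDirection S k) :
    (S.affineBasis.coord i).linear u = 0 := by
  have : flagDirection S k ≤ LinearMap.ker (S.affineBasis.coord i).linear := by
    rw [flagDirection, vectorSpan_def, Submodule.span_le]
    rintro _ ⟨_, ⟨a, ha, rfl⟩, _, ⟨c, hc, rfl⟩, rfl⟩
    have h : ∀ a : Fin (n + 1), (a : ℕ) ≤ k → S.affineBasis.coord i (S.points a) = 0 :=
      fun a ha ↦ S.affineBasis.coord_apply_ne (by rintro rfl; omega)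
    simp only [SetLike.mem_coe, LinearMap.mem_ker]
    rw [AffineMap.linearMap_vsub, h a ha, h c hc, vsub_self]
  exact this hu

theorem coord_eq_sum (f : EuclideanSpace ℝ (Fin n) →ᵃ[ℝ] ℝ) (x : EuclideanSpace ℝ (Fin n)) :
    f x = ∑ m, S.affineBasis.coord m x * f (S.points m) := by
  have hx := S.affineBasis.affineCombination_coord_eq_self x
  have h1 := S.affineBasis.sum_coord_apply_eq_one x
  conv_lhs => rw [← hx]
  rw [Finset.map_affineCombination _ _ _ h1,
    Finset.affineCombination_eq_linear_combination _ _ _ h1]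
  rfl

/-- In a convex set with a conical face containing the `k`-face of the flag of `S`, the segments
with midpoint `x ∈ S` are short in the directions transversal to that face. -/
theorem exists_abs_coord_linear_le (hk : k ≤ n) (hSK : S.closedInterior ⊆ K)
    {f : Set (EuclideanSpace ℝ (Fin n))} (hf : IsConicalKFace k K f) (hSf : flagFace S k ⊆ f) :
    ∃ M : ℝ, 0 ≤ M ∧ ∀ i : Fin (n + 1), k < i → ∀ x ∈ S.closedInterior, ∀ u,
      x + u ∈ K → x - u ∈ K → |(S.affineBasis.coord i).linear u| ≤
        M * ∑ m : Fin (n + 1) with k < m.val, S.affineBasis.coord m x := by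
  classical
  obtain ⟨-, T, hKT, g, ⟨⟨x₀, hx₀, rfl⟩, hdim⟩, hfg⟩ := hf
  have hST := hSK.trans hKT
  have hF := hSf.trans hfg
  let J := {j : Fin (n + 1) // T.affineBasis.coord j x₀ = 0}
  have hspan : ∀ i : Fin (n + 1), k < i → ∃ a : J → ℝ,
      ∑ j, a j • (T.affineBasis.coord j.1).linear = (S.affineBasis.coord i).linear := by
    intro i hi
    -- Duality: a functional vanishing on the common kernel of finitely many functionals is a
    -- combination of them.
    refine (Submodule.mem_span_range_iff_exists_fun ℝ).1 (mem_span_of_iInf_ker_le_ker ?_)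
    intro u hu
    rw [Submodule.mem_iInf] at hu
    exact coord_linear_eq_zero_of_lt hi (mem_flagDirection_of_coord_linear_eq_zero hk hST hx₀ hF
      hdim fun j hj ↦ hu ⟨j, hj⟩)
  choose! a ha using hspan
  refine ⟨∑ i, ∑ j, |a i j| * ∑ m, T.affineBasis.coord j.1 (S.points m), ?_, ?_⟩
  · refine Finset.sum_nonneg fun i _ ↦ Finset.sum_nonneg fun j _ ↦ mul_nonneg (abs_nonneg _) ?_
    exact Finset.sum_nonneg fun m _ ↦
      T.mem_closedInterior_iff_coord.1 (hST (S.point_mem_closedInterior m)) _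
  intro i hi x hx u hp hm
  have hpos : ∀ m (j : Fin (n + 1)), 0 ≤ T.affineBasis.coord j (S.points m) := fun m ↦
    T.mem_closedInterior_iff_coord.1 (hST (S.point_mem_closedInterior m))
  have hxpos := S.mem_closedInterior_iff_coord.1 hx
  set σ := ∑ m : Fin (n + 1) with k < m.val, S.affineBasis.coord m x with hσ
  have hσ0 : 0 ≤ σ := Finset.sum_nonneg fun m _ ↦ hxpos m
  have hj : ∀ j : J, |(T.affineBasis.coord j.1).linear u| ≤
      (∑ m, T.affineBasis.coord j.1 (S.points m)) * σ := by
    intro j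
    have h1 := T.mem_closedInterior_iff_coord.1 (hKT hp) j.1
    have h2 := T.mem_closedInterior_iff_coord.1 (hKT hm) j.1
    rw [sub_eq_add_neg] at h2
    rw [AffineBasis.coord_add] at h1 h2
    rw [map_neg] at h2
    -- Nonnegativity of the coordinate at `x + u` and `x - u` bounds its linear part by its value at
    -- `x`; expanded over the vertices of `S`, only those with index above `k` contribute.
    refine (abs_le.2 ⟨by linarith, by linarith⟩ : _ ≤ T.affineBasis.coord j.1 x).trans ?_
    rw [coord_eq_sum (S := S) (T.affineBasis.coord j.1) x, hσ, Finset.mul_sum,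
      ← Finset.sum_filter_add_sum_filter_not Finset.univ (fun m : Fin (n + 1) ↦ k < (m : ℕ))]
    rw [Finset.sum_eq_zero (s := Finset.univ.filter fun m : Fin (n + 1) ↦ ¬ k < (m : ℕ)), add_zero]
    · refine Finset.sum_le_sum fun m _ ↦ ?_
      rw [mul_comm]
      exact mul_le_mul_of_nonneg_right
        (Finset.single_le_sum (fun m _ ↦ hpos m _) (Finset.mem_univ m)) (hxpos m)
    · intro m hmk
      rw [coord_points_eq_zero hST hF j.2 (by simpa using hmk), mul_zero]
  rw [← ha i hi, LinearMap.sum_apply]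
  refine (Finset.abs_sum_le_sum_abs _ _).trans ?_
  have hrow : ∑ j, |(a i j • (T.affineBasis.coord j.1).linear) u| ≤
      (∑ j, |a i j| * ∑ m, T.affineBasis.coord j.1 (S.points m)) * σ := by
    rw [Finset.sum_mul]
    refine Finset.sum_le_sum fun j _ ↦ ?_
    rw [LinearMap.smul_apply, smul_eq_mul, abs_mul, mul_assoc]
    exact mul_le_mul_of_nonneg_left (hj j) (abs_nonneg _)
  refine hrow.trans (mul_le_mul_of_nonneg_right ?_ hσ0)
  exact Finset.single_le_sum
    (f := fun i ↦ ∑ j, |a i j| * ∑ m, T.affineBasis.coord j.1 (S.points m))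
    (fun i _ ↦ Finset.sum_nonneg fun j _ ↦ mul_nonneg (abs_nonneg _)
      (Finset.sum_nonneg fun m _ ↦ hpos m _)) (Finset.mem_univ i)

end Conical

/-! ### Shrinking segments of one set into the other -/

section Comparison

variable {n : ℕ} {S : Affine.Simplex ℝ (EuclideanSpace ℝ (Fin n)) n}
  {K L : Set (EuclideanSpace ℝ (Fin n))} {x y z u : EuclideanSpace ℝ (Fin n)} {k : ℕ}

theorem Convex.exists_pos_forall_abs_le_add_smul_mem (hK : Convex ℝ K)
    (hp : ∃ ε : ℝ, 0 < ε ∧ y + ε • u ∈ K) (hm : ∃ ε : ℝ, 0 < ε ∧ y + ε • (-u) ∈ K) :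
    ∃ ε : ℝ, 0 < ε ∧ ∀ t : ℝ, |t| ≤ ε → y + t • u ∈ K := by
  obtain ⟨a, ha, h1⟩ := hp
  obtain ⟨b, hb, h2⟩ := hm
  refine ⟨min a b, lt_min ha hb, fun t ht ↦ ?_⟩
  have h3 : -b ≤ t := (neg_le_neg (ht.trans (min_le_right a b))).trans (neg_abs_le t)
  have h4 : t ≤ a := (le_abs_self t).trans (ht.trans (min_le_left a b))
  have hab : 0 < a + b := add_pos ha hb
  have := hK h1 h2 (a := (t + b) / (a + b)) (b := (a - t) / (a + b))
    (div_nonneg (by linarith) hab.le) (div_nonneg (by linarith) hab.le) (by field_simp; ring)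
  convert this using 1
  match_scalars <;> field_simp <;> ring

/-- The point is the average of the `N` points `y + (N * δ j) • d j`, where `N` is the number of
directions. -/
theorem Convex.add_sum_smul_mem {ι : Type*} [Fintype ι] [Nonempty ι]
    {d : ι → EuclideanSpace ℝ (Fin n)} {ε : ℝ} (hK : Convex ℝ K)
    (h : ∀ j, ∀ t : ℝ, |t| ≤ ε → y + t • d j ∈ K) {δ : ι → ℝ}
    (hδ : ∀ j, |δ j| ≤ ε / Fintype.card ι) : y + ∑ j, δ j • d j ∈ K := by
  have hc : (0 : ℝ) < Fintype.card ι := by exact_mod_cast Fintype.card_pos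
  have := hK.sum_mem (t := Finset.univ) (w := fun _ : ι ↦ 1 / (Fintype.card ι : ℝ))
    (z := fun j ↦ y + ((Fintype.card ι : ℝ) * δ j) • d j) (fun _ _ ↦ by positivity)
    (by simp [hc.ne']) (fun j _ ↦ h j _ (by
      rw [abs_mul, abs_of_pos hc, mul_comm]
      exact (le_div_iff₀ hc).1 (hδ j)))
  convert this using 1
  simp only [smul_add, Finset.sum_add_distrib, smul_smul]
  congr 1
  · rw [← Finset.sum_smul]
    simp [hc.ne']
  · refine Finset.sum_congr rfl fun j _ ↦ ?_
    congr 1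
    field_simp

/-- Each vertex `vᵢ` in the relative interior of the `i`-face along the flag has a neighbourhood
in the span of `v₀, …, vᵢ` that is contained in the convex set. -/
theorem exists_pos_forall_points_add_sum_mem (hK : Convex ℝ K) (hSK : S.closedInterior ⊆ K)
    {f : Fin (n + 1) → Set (EuclideanSpace ℝ (Fin n))}
    (hf : ∀ k : Fin (n + 1), IsKFace k K (f k)) (hSf : ∀ k : Fin (n + 1), flagFace S k ⊆ f k)
    (hv : ∀ k, S.points k ∈ f k) :
    ∃ ε : ℝ, 0 < ε ∧ ∀ (i : Fin (n + 1)) (δ : Fin (n + 1) → ℝ), (∀ j, |δ j| ≤ ε) →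
      S.points i + ∑ j with j ≤ i, δ j • (S.points j - S.points 0) ∈ K := by
  let d : Fin (n + 1) → Fin (n + 1) → EuclideanSpace ℝ (Fin n) := fun i j ↦
    if j ≤ i then S.points j - S.points 0 else 0
  have hd : ∀ i j : Fin (n + 1), d i j ∈ flagDirection S i := by
    intro i j
    by_cases h : j ≤ i
    · simp only [d, if_pos h]
      exact sub_mem_flagDirection S h (by simp)
    · simp only [d, if_neg h]
      exact zero_mem _
  have h1 : ∀ i j, ∃ ε : ℝ, 0 < ε ∧ ∀ t : ℝ, |t| ≤ ε → S.points i + t • d i j ∈ K := by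
    intro i j
    have hvi := hv i
    have hSi := hSf i
    obtain ⟨⟨x₀, hx₀, h⟩, -⟩ := hf i
    rw [h] at hvi hSi
    exact hK.exists_pos_forall_abs_le_add_smul_mem
      (FaceEquiv.exists_pos_add_smul_mem_of_flagFace_subset hK hSK hSi hvi (hd i j))
      (FaceEquiv.exists_pos_add_smul_mem_of_flagFace_subset hK hSK hSi hvi (neg_mem (hd i j)))
  have h2 : ∀ᶠ ε in 𝓝[>] (0 : ℝ), ∀ i j, ∀ t : ℝ, |t| ≤ ε → S.points i + t • d i j ∈ K := by
    refine eventually_all.2 fun i ↦ eventually_all.2 fun j ↦ ?_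
    obtain ⟨ε, hε, h⟩ := h1 i j
    filter_upwards [Ioc_mem_nhdsGT hε] with r hr t ht
    exact h t (ht.trans hr.2)
  obtain ⟨ε, h, hε⟩ := (h2.and (self_mem_nhdsWithin : Ioi (0 : ℝ) ∈ 𝓝[>] 0)).exists
  have hε : 0 < ε := hε
  refine ⟨ε / Fintype.card (Fin (n + 1)), div_pos hε (by exact_mod_cast Fintype.card_pos), ?_⟩
  intro i δ hδ
  convert hK.add_sum_smul_mem (h i) hδ using 2
  rw [Finset.sum_filter]
  refine Finset.sum_congr rfl fun j _ ↦ ?_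
  simp only [d]
  split_ifs <;> simp

/-- If both convex sets have the flag of `S` in conical faces, then a segment in `L` with midpoint
`x ∈ S` is, after shrinking by a uniform factor, contained in `K`. -/
theorem exists_pos_forall_add_smul_mem (hK : Convex ℝ K) (hSK : S.closedInterior ⊆ K)
    (hSL : S.closedInterior ⊆ L) {f g : Fin (n + 1) → Set (EuclideanSpace ℝ (Fin n))}
    (hf : ∀ k : Fin (n + 1), IsKFace k K (f k)) (hSf : ∀ k : Fin (n + 1), flagFace S k ⊆ f k)
    (hv : ∀ k, S.points k ∈ f k)
    (hg : ∀ k : Fin (n + 1), IsConicalKFace k L (g k) ∧ flagFace S k ⊆ g k) :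
    ∃ c : ℝ, 0 < c ∧ ∀ x ∈ S.closedInterior, ∀ u, x + u ∈ L → x - u ∈ L → x + c • u ∈ K := by
  obtain ⟨ε, hε, hε'⟩ := exists_pos_forall_points_add_sum_mem hK hSK hf hSf hv
  have hM := fun k : Fin (n + 1) ↦ exists_abs_coord_linear_le k.is_le hSL (hg k).1 (hg k).2
  choose M hM0 hM using hM
  have hM1 : 0 < ∑ k, M k + 1 := by
    have := Finset.sum_nonneg fun k (_ : k ∈ Finset.univ) ↦ hM0 k
    linarith
  -- Chosen so that `c * |μ j| / σ j ≤ ε`; the `+ 1` keeps the denominator positive.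
  set c := ε / (∑ k, M k + 1) with hc
  have hc0 : 0 < c := div_pos hε hM1
  refine ⟨c, hc0, fun x hx u hp hm ↦ ?_⟩
  have hxpos := S.mem_closedInterior_iff_coord.1 hx
  set l : Fin (n + 1) → ℝ := fun i ↦ S.affineBasis.coord i x with hl
  set μ : Fin (n + 1) → ℝ := fun i ↦ (S.affineBasis.coord i).linear u with hμ
  set σ : Fin (n + 1) → ℝ := fun j ↦ ∑ m with j ≤ m, l m with hσ
  have hσ0 : ∀ j, 0 ≤ σ j := fun j ↦ Finset.sum_nonneg fun m _ ↦ hxpos m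
  have hbound : ∀ i, i ≠ 0 → |μ i| ≤ (∑ k, M k) * σ i := by
    intro i hi
    have hi' : (i : ℕ) ≠ 0 := fun h ↦ hi (Fin.ext h)
    -- Level `k = i - 1` turns the sum over `m > k` into `σ i`. No bound is needed for `i = 0`,
    -- since `v₀ - v₀ = 0`.
    have h := hM ⟨i - 1, by omega⟩ i (by simp only; omega) x hx u hp hm
    have hs : (∑ m : Fin (n + 1) with i.val - 1 < m.val, S.affineBasis.coord m x) = σ i := by
      refine Finset.sum_congr (Finset.filter_congr fun m _ ↦ ?_) fun _ _ ↦ rfl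
      rw [Fin.le_def]
      omega
    rw [hs] at h
    exact h.trans (mul_le_mul_of_nonneg_right
      (Finset.single_le_sum (fun k _ ↦ hM0 k) (Finset.mem_univ _)) (hσ0 i))
  -- If `σ j = 0` with `j ≠ 0`, then `μ j = 0` by `hbound`, so the default value of division by zero
  -- is the right one.
  let δ : Fin (n + 1) → ℝ := fun j ↦ if j = 0 then 0 else c * (μ j / σ j)
  have hδ : ∀ j, |δ j| ≤ ε := by
    intro j
    by_cases hj : j = 0
    · simp [δ, hj, hε.le]
    · simp only [δ, if_neg hj]
      rw [abs_mul, abs_of_pos hc0, abs_div, abs_of_nonneg (hσ0 j), hc, div_mul_eq_mul_div,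
        div_le_iff₀ hM1]
      refine mul_le_mul_of_nonneg_left ?_ hε.le
      refine (div_le_of_le_mul₀ (hσ0 j) ?_ (hbound j hj)).trans (by linarith)
      exact Finset.sum_nonneg fun k _ ↦ hM0 k
  have hδσ : ∀ j, j ≠ 0 → δ j * σ j = c * μ j := by
    intro j hj
    simp only [δ, if_neg hj]
    rcases (hσ0 j).eq_or_lt with h | h
    · have := hbound j hj
      rw [← h, mul_zero] at this
      rw [abs_nonpos_iff.1 this]
      simp
    · field_simp
  have hsum := hK.sum_mem (t := Finset.univ) (w := l) (fun i _ ↦ hxpos i)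
    (S.affineBasis.sum_coord_apply_eq_one x) (fun i _ ↦ hε' i δ hδ)
  convert hsum using 1
  have hxl : ∑ i, l i • S.points i = x := S.affineBasis.linear_combination_coord_eq_self x
  have hu : u = ∑ j, μ j • (S.points j - S.points 0) := by
    have hμ' : ∀ j, μ j = S.affineBasis.coord j (x + u) - S.affineBasis.coord j x := by
      intro j
      rw [AffineBasis.coord_add, add_sub_cancel_left]
    have h1 : ∑ j, S.affineBasis.coord j (x + u) • S.points j = x + u :=
      S.affineBasis.linear_combination_coord_eq_self (x + u)
    simp only [smul_sub, Finset.sum_sub_distrib, ← Finset.sum_smul]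
    simp only [hμ', sub_smul, Finset.sum_sub_distrib, AffineBasis.sum_coord_apply_eq_one]
    rw [h1, hxl]
    simp
  have hswap : ∑ i, l i • ∑ j with j ≤ i, δ j • (S.points j - S.points 0) =
      ∑ j, (δ j * σ j) • (S.points j - S.points 0) := by
    simp only [Finset.smul_sum, Finset.sum_filter, hσ, Finset.mul_sum, Finset.sum_smul]
    rw [Finset.sum_comm]
    refine Finset.sum_congr rfl fun j _ ↦ Finset.sum_congr rfl fun i _ ↦ ?_
    split_ifs
    · rw [smul_smul, mul_comm]
    · simp
  simp only [smul_add, Finset.sum_add_distrib]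
  rw [hxl, hswap]
  congr 1
  conv_lhs => rw [hu]
  rw [Finset.smul_sum]
  refine Finset.sum_congr rfl fun j _ ↦ ?_
  by_cases hj : j = 0
  · simp [hj]
  · rw [hδσ j hj, smul_smul]

end Comparison

/-! ### Exit times and the Finsler norm -/

section Finsler

variable {n : ℕ} {A B : Set (EuclideanSpace ℝ (Fin n))} {p v : EuclideanSpace ℝ (Fin n)}

/-- The time at which the half-line that starts at `p` with velocity `v` leaves `C`. -/
noncomputable def exitTime (C : Set (EuclideanSpace ℝ (Fin n)))
    (p v : EuclideanSpace ℝ (Fin n)) : ℝ :=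
  sSup {t : ℝ | 0 ≤ t ∧ p + t • v ∈ C}

theorem IsConvexDomain.bddAbove_exitTime (hA : IsConvexDomain A) (hv : v ≠ 0) :
    BddAbove {t : ℝ | 0 ≤ t ∧ p + t • v ∈ A} := by
  obtain ⟨R, hR⟩ := hA.isBounded.exists_norm_le
  refine ⟨(R + ‖p‖) / ‖v‖, fun t ⟨ht, hmem⟩ ↦ ?_⟩
  rw [le_div_iff₀ (norm_pos_iff.2 hv)]
  calc t * ‖v‖ = ‖(p + t • v) - p‖ := by
        rw [add_sub_cancel_left, norm_smul, Real.norm_of_nonneg ht]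
    _ ≤ ‖p + t • v‖ + ‖p‖ := norm_sub_le _ _
    _ ≤ R + ‖p‖ := by linarith [hR _ hmem]

/-- Points strictly between an interior point and a point of the closure are interior, so every time
`r < s` is admissible. -/
theorem IsConvexDomain.le_exitTime (hA : IsConvexDomain A) (hv : v ≠ 0) (hp : p ∈ A) {s : ℝ}
    (hs : 0 ≤ s) (h : p + s • v ∈ closure A) : s ≤ exitTime A p v := by
  refine le_of_forall_lt_imp_le_of_dense fun r hr ↦ ?_
  rcases lt_or_ge r 0 with hr0 | hr0
  · refine hr0.le.trans (Real.sSup_nonneg fun t ht ↦ ht.1)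
  refine le_csSup (hA.bddAbove_exitTime hv) ⟨hr0, ?_⟩
  have hspos : 0 < s := hr0.trans_lt hr
  have := hA.convex.combo_interior_closure_mem_interior (x := p) (y := p + s • v)
    (a := 1 - r / s) (b := r / s) (by rwa [hA.isOpen.interior_eq]) h
    (by rw [sub_pos]; exact (div_lt_one hspos).2 hr) (div_nonneg hr0 hs) (by ring)
  rw [hA.isOpen.interior_eq] at this
  convert this using 1
  match_scalars
  · ring
  · field_simp

theorem IsConvexDomain.exitTime_pos (hA : IsConvexDomain A) (hv : v ≠ 0) (hp : p ∈ A) :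
    0 < exitTime A p v := by
  have h : ∀ᶠ t in 𝓝 (0 : ℝ), p + t • v ∈ A := by
    have : Tendsto (fun t : ℝ ↦ p + t • v) (𝓝 0) (𝓝 (p + (0 : ℝ) • v)) :=
      Continuous.tendsto (by fun_prop) 0
    exact this.eventually_mem (hA.isOpen.mem_nhds (by simpa using hp))
  obtain ⟨t, ht, ht0⟩ := ((h.filter_mono nhdsWithin_le_nhds).and
    (self_mem_nhdsWithin : Ioi (0 : ℝ) ∈ 𝓝[>] 0)).exists
  exact lt_of_lt_of_le ht0 (hA.le_exitTime hv hp (le_of_lt ht0) (subset_closure ht))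

theorem IsConvexDomain.add_smul_mem_closure (hA : IsConvexDomain A) (hv : v ≠ 0) (hp : p ∈ A)
    {s : ℝ} (hs : 0 ≤ s) (h : s ≤ exitTime A p v) : p + s • v ∈ closure A := by
  have hcl : p + exitTime A p v • v ∈ closure A := by
    have h1 := csSup_mem_closure (s := {t : ℝ | 0 ≤ t ∧ p + t • v ∈ A})
      ⟨0, le_rfl, by simpa using hp⟩ (hA.bddAbove_exitTime hv)
    refine map_mem_closure (f := fun t : ℝ ↦ p + t • v) (by fun_prop) h1 fun t ht ↦ ht.2
  have hpos := hA.exitTime_pos hv hp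
  have := hA.convex.closure (subset_closure hp) hcl (a := 1 - s / exitTime A p v)
    (b := s / exitTime A p v) (by rw [sub_nonneg]; exact (div_le_one hpos).2 h)
    (div_nonneg hs hpos.le) (by ring)
  convert this using 1
  match_scalars
  · ring
  · field_simp

theorem IsConvexDomain.hilbertFinsler_eq (hA : IsConvexDomain A) (hv : v ≠ 0) (hp : p ∈ A) :
    hilbertFinsler A p v = 1 / 2 * (1 / exitTime A p (-v) + 1 / exitTime A p v) := by
  have h : ∀ w : EuclideanSpace ℝ (Fin n), w ≠ 0 →
      ‖p - exitPoint A p w‖ = exitTime A p w * ‖w‖ := by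
    intro w hw
    rw [exitPoint, sub_add_cancel_left, norm_neg, norm_smul, ← exitTime,
      Real.norm_of_nonneg (hA.exitTime_pos hw hp).le]
  rw [hilbertFinsler, h v hv, h (-v) (neg_ne_zero.2 hv), norm_neg]
  have h1 := norm_pos_iff.2 hv
  have h2 := hA.exitTime_pos hv hp
  have h3 := hA.exitTime_pos (neg_ne_zero.2 hv) hp
  field_simp

theorem hilbertFinsler_zero (C : Set (EuclideanSpace ℝ (Fin n))) : hilbertFinsler C p 0 = 0 := by
  simp [hilbertFinsler]

/-- If segments of `B` with midpoint `p` shrunk by the factor `c` are contained in `A`, then the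
Finsler norm of `A` at `p` is bounded by that of `B` times `2 / c`. -/
theorem IsConvexDomain.hilbertFinsler_le (hA : IsConvexDomain A) (hB : IsConvexDomain B)
    (hpA : p ∈ A) (hpB : p ∈ B) {c : ℝ} (hc : 0 < c)
    (h : ∀ u, p + u ∈ closure B → p - u ∈ closure B → p + c • u ∈ closure A) :
    hilbertFinsler A p v ≤ 2 / c * hilbertFinsler B p v := by
  rcases eq_or_ne v 0 with rfl | hv
  · simp [hilbertFinsler_zero]
  rw [hA.hilbertFinsler_eq hv hpA, hB.hilbertFinsler_eq hv hpB]
  have key : ∀ w : EuclideanSpace ℝ (Fin n), w ≠ 0 →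
      1 / exitTime A p w ≤ 1 / c * (1 / exitTime B p (-w) + 1 / exitTime B p w) := by
    intro w hw
    have h1 := hB.exitTime_pos hw hpB
    have h2 := hB.exitTime_pos (neg_ne_zero.2 hw) hpB
    set m := min (exitTime B p w) (exitTime B p (-w)) with hm
    have hm0 : 0 < m := lt_min h1 h2
    -- With `m` the smaller exit time, both `p ± m • w` lie in `closure B`; then `1 / m` is at most
    -- the sum of the two inverse exit times.
    have h3 := hB.add_smul_mem_closure hw hpB hm0.le (min_le_left _ _)
    have h4 := hB.add_smul_mem_closure (neg_ne_zero.2 hw) hpB hm0.le (min_le_right _ _)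
    have h5 := h (m • w) h3 (by rwa [smul_neg, ← sub_eq_add_neg] at h4)
    rw [smul_smul] at h5
    have h6 := hA.le_exitTime hw hpA (mul_pos hc hm0).le h5
    refine (one_div_le_one_div_of_le (mul_pos hc hm0) h6).trans ?_
    rw [one_div_mul_eq_div, one_div, mul_inv, mul_comm, ← div_eq_mul_inv]
    refine div_le_div_of_nonneg_right ?_ hc.le
    have h7 := one_div_pos.2 h1
    have h8 := one_div_pos.2 h2
    rw [← one_div]
    rcases min_choice (exitTime B p w) (exitTime B p (-w)) with h | h <;> rw [hm, h] <;> linarith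
  have k1 := key v hv
  have k2 := key (-v) (neg_ne_zero.2 hv)
  rw [neg_neg] at k2
  calc 1 / 2 * (1 / exitTime A p (-v) + 1 / exitTime A p v)
      ≤ 1 / 2 * (1 / c * (1 / exitTime B p v + 1 / exitTime B p (-v)) +
        1 / c * (1 / exitTime B p (-v) + 1 / exitTime B p v)) := by gcongr
    _ = 2 / c * (1 / 2 * (1 / exitTime B p (-v) + 1 / exitTime B p v)) := by ring

theorem hilbertFinsler_nonneg (C : Set (EuclideanSpace ℝ (Fin n))) : 0 ≤ hilbertFinsler C p v := by
  unfold hilbertFinsler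
  positivity

end Finsler

theorem mainTheorem3 {n : ℕ} (hn : 1 ≤ n)
    (A B : Set (EuclideanSpace ℝ (Fin n)))
    (hA : IsConvexDomain A) (hB : IsConvexDomain B)
    (S : Affine.Simplex ℝ (EuclideanSpace ℝ (Fin n)) n)
    (hSA : S.closedInterior ⊆ closure A) (hSB : S.closedInterior ⊆ closure B)
    -- exactly one `(n-1)`-face of `S`, with its adjacent lower-dimensional faces,
    -- lies in the boundaries of both sets
    (h_facet : ∀ f, IsKFace (n - 1) S.closedInterior f →
      (closure f ⊆ frontier A ∩ frontier B ↔ f = flagFace S (n - 1)))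
    -- for every `k`, exactly one `k`-face of `S` lies in a `k`-face of `A` and in one of `B`
    (h_unique : ∀ k : Fin (n + 1), ∀ f, IsKFace k S.closedInterior f →
      (((∃ g, IsKFace k (closure A) g ∧ f ⊆ g) ∧ (∃ g, IsKFace k (closure B) g ∧ f ⊆ g)) ↔
        f = flagFace S k))
    -- these `k`-faces of `A` and of `B` are conical
    (A' B' : Fin (n + 1) → Set (EuclideanSpace ℝ (Fin n)))
    (hA' : ∀ k : Fin (n + 1), IsConicalKFace k (closure A) (A' k) ∧ flagFace S k ⊆ A' k)
    (hB' : ∀ k : Fin (n + 1), IsConicalKFace k (closure B) (B' k) ∧ flagFace S k ⊆ B' k)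
    -- the vertex that the `k`-th face of the flag has in addition to the previous ones lies in
    -- the (relatively open) `k`-faces of `A` and of `B`
    (h_vertex : ∀ k : Fin (n + 1), S.points k ∈ A' k ∩ B' k) :
    ∃ C : ℝ, 0 < C ∧ ∀ x ∈ S.closedInterior ∩ A ∩ B, ∀ v : EuclideanSpace ℝ (Fin n),
      1 / C * hilbertFinsler B x v ≤ hilbertFinsler A x v ∧
        hilbertFinsler A x v ≤ C * hilbertFinsler B x v := by
  obtain ⟨a, ha, hAB⟩ := exists_pos_forall_add_smul_mem hA.convex.closure hSA hSB
    (fun k ↦ (hA' k).1.1) (fun k ↦ (hA' k).2) (fun k ↦ (h_vertex k).1) hB'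
  obtain ⟨b, hb, hBA⟩ := exists_pos_forall_add_smul_mem hB.convex.closure hSB hSA
    (fun k ↦ (hB' k).1.1) (fun k ↦ (hB' k).2) (fun k ↦ (h_vertex k).2) hA'
  have hC : 0 < max (2 / a) (2 / b) := lt_max_of_lt_left (by positivity)
  refine ⟨max (2 / a) (2 / b), hC, fun x ⟨⟨hxS, hxA⟩, hxB⟩ v ↦ ⟨?_, ?_⟩⟩
  · rw [one_div_mul_eq_div, div_le_iff₀ hC, mul_comm]
    exact (hB.hilbertFinsler_le hA hxB hxA hb (hBA x hxS)).trans
      (mul_le_mul_of_nonneg_right (le_max_right _ _) (hilbertFinsler_nonneg A))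
  · exact (hA.hilbertFinsler_le hB hxA hxB ha (hAB x hxS)).trans
      (mul_le_mul_of_nonneg_right (le_max_left _ _) (hilbertFinsler_nonneg B))
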